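/- **Setting.** Let $D$ be an oriented virtual link diagram: a generic immersion of finitely many oriented circles in the plane, each double point being a positive, a negative, or a virtual crossing. A short arc runs from one crossing (of any kind) to the next; a component without crossings is a short arc too. The *virtual knot group* $VG_D$ has one generator for each short arc and two further generators $s,q$, the relation $[s,q]=1$, and two relations for each crossing. Draw the crossing with both strands pointing upwards, and let $a,b$ be the bottom left and bottom right incoming arcs and $c,d$ the top left and top right outgoing arcs. The relations are - positive crossing (left-to-right strand over): $d=sas^{-1}$, $c=ab\,(sa^{-1}s^{-1})$; - negative crossing (right-to-left strand over): $c=s^{-1}bs$, $d=(s^{-1}b^{-1}s)\,ab$; - virtual crossing: $d=qaq^{-1}$, $c=q^{-1}bq$. A component without crossings contributes the trivial relation. If $D$ represents the virtual knot or link $K$, then $VG_D$ is the virtual knot group $VG_K$. Let $\alpha\colon VG_D\to\mathbb Z^3=\langle s,t,q\rangle$ send every short arc to $t$, $s$ to $s$ and $q$ to $q$. Let $R$ be a unique factorization domain, $\mathcal L_R=R[s^{\pm1},t^{\pm1},q^{\pm1}]$, and $\varrho\colon VG_D\to GL_n(R)$ a representation. Let $F$ be the free group on the generators $x_1,\dots,x_m$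 of the above presentation, $r_i$ its relators, and $\Omega\colon\mathbb ZF\to M_n(\mathcal L_R)$ the ring homomorphism with $\Omega(w)=\alpha(w)\varrho(w)$ for $w \in F$. Let $M=\big(\Omega(\partial r_i/\partial x_j)\big)$ be the block matrix of Fox derivatives and $\widehat M_j$ the matrix $M$ without its $j$-th block column. For any $j$ with $\det\Omega(1-x_j)\ne0$, the *twisted virtual Alexander polynomial* is $$H^\varrho_K(s,t,q)=\frac{Q_j}{\det\Omega(1-x_j)},$$ where $Q_j$ is a greatest common divisor of the maximal minors (those of size $n(m-1)$) of $\widehat M_j$; it is defined up to units of $\mathcal L_R$. Since the presentation has one generator more than relators, $\widehat M_j$ is square, and one may take $Q_j=\det\widehat M_j$ (with the relators listed in any order). This gives the normalized values of $H^\varrho_K$, which are considered up to a factor $\varepsilon(s^{e_1}t^{e_2}q^{e_3})^n$ with $\varepsilon\in R^\times$ and $e_i\in\mathbb Z$; if $\varrho$ takes values in $SL_n(R)$, they are considered up to a factor $\pm(s^{e_1}t^{e_2}q^{e_3})^n$, with the sign $+$ if $n$ is even. **Theorem.** For every such $D$, $n$, $R$ and every representation $\varrho\colon VG_K\to GL_n(R)$,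 the twisted virtual Alexander polynomial exists as an element of $\mathcal L_R$ (some normalized value lies in $\mathcal L_R$ and is also a value in the first sense), and it satisfies $$H^\varrho_K(s,t,q)=H^\varrho_K(sq^{-1},tq,1).$$ The equality holds up to units of $\mathcal L_R$ for any two values (one on each side), and for any two normalized values it holds up to the smaller indeterminacy just described, in both the general and the unimodular case. -/

import Mathlib

/-! ### Laurent polynomials -/

/-- The ring `R[t₁^{±1}, …, t_m^{±1}]` of Laurent polynomials, as the group ring of `ℤ^m`. -/
abbrev LaurentRing (R : Type*) [CommRing R] (m : ℕ) : Type _ :=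
  AddMonoidAlgebra R (Fin m → ℤ)

namespace LaurentRing

variable {R : Type*} [CommRing R] {m : ℕ}

/-- The monomial `t₁^{e₁} ⋯ t_m^{e_m}`, for `e ∈ ℤ^m` written multiplicatively. -/
noncomputable def monomial (R : Type*) [CommRing R] {m : ℕ} :
    Multiplicative (Fin m → ℤ) →* LaurentRing R m :=
  AddMonoidAlgebra.of R (Fin m → ℤ)

/-- The monomials are units. -/
noncomputable def unitMonomial (R : Type*) [CommRing R] {m : ℕ} :
    Multiplicative (Fin m → ℤ) →* (LaurentRing R m)ˣ :=
  (monomial R).toHomUnits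

/-- The variable `tᵢ`, a unit. -/
noncomputable def var (R : Type*) [CommRing R] {m : ℕ} (i : Fin m) : (LaurentRing R m)ˣ :=
  unitMonomial R (Multiplicative.ofAdd (Pi.single i 1))

/-- The constant Laurent polynomials. -/
noncomputable def const : R →+* LaurentRing R m := algebraMap R (LaurentRing R m)

/-- `e ↦ ∏ i, (u i) ^ (e i)`. -/
noncomputable def powHom {A : Type*} [CommRing A] (u : Fin m → Aˣ) :
    Multiplicative (Fin m → ℤ) →* A where
  toFun e := ((∏ i, u i ^ (Multiplicative.toAdd e i) : Aˣ) : A)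
  map_one' := by simp
  map_mul' a b := by simp [zpow_add, Finset.prod_mul_distrib]

/-- Evaluation `f ↦ f(u₁, …, u_m)` at units `u₁, …, u_m` of an `R`-algebra. -/
noncomputable def eval {A : Type*} [CommRing A] [Algebra R A] (u : Fin m → Aˣ) :
    LaurentRing R m →ₐ[R] A :=
  AddMonoidAlgebra.lift R A (Fin m → ℤ) (powHom u)

theorem eval_var {A : Type*} [CommRing A] [Algebra R A] (u : Fin m → Aˣ) (i : Fin m) :
    eval (R := R) u (var R i : (LaurentRing R m)ˣ) = u i := by
  classical
  have h : ∏ x, u x ^ (Pi.single i (1 : ℤ) : Fin m → ℤ) x = u i := by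
    rw [Finset.prod_eq_single i] <;> simp +contextual
  have h' := congrArg (Units.val) h
  simpa [eval, var, unitMonomial, monomial, powHom, AddMonoidAlgebra.lift_single] using h'

end LaurentRing

/-! ### Fox derivatives -/

section Fox

variable {X : Type*} [DecidableEq X]

/-- The group `F` acting on `ℤF` by left multiplication. -/
noncomputable def foxAction (X : Type*) :
    FreeGroup X →* MulAut (Multiplicative (MonoidAlgebra ℤ (FreeGroup X))) :=
  (MulAutMultiplicative (MonoidAlgebra ℤ (FreeGroup X))).symm.toMonoidHom.comp
    (AddAut.mulLeft.comp (MonoidAlgebra.of ℤ (FreeGroup X)).toHomUnits)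

/-- The homomorphism `F → ℤF ⋊ F`, `w ↦ (∂w/∂xⱼ, w)`. -/
noncomputable def foxHom (j : X) :
    FreeGroup X →* Multiplicative (MonoidAlgebra ℤ (FreeGroup X)) ⋊[foxAction X] FreeGroup X :=
  FreeGroup.lift fun i => ⟨Multiplicative.ofAdd (if i = j then 1 else 0), FreeGroup.of i⟩

/-- The Fox derivative `∂w/∂xⱼ ∈ ℤF` of a word `w` in the free group `F` on `X`. It is
characterized by `∂xᵢ/∂xⱼ = δᵢⱼ` and `∂(vw)/∂xⱼ = ∂v/∂xⱼ + v ∂w/∂xⱼ`, see below. -/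
noncomputable def foxDeriv (w : FreeGroup X) (j : X) : MonoidAlgebra ℤ (FreeGroup X) :=
  Multiplicative.toAdd (foxHom j w).left

theorem foxHom_right (j : X) (w : FreeGroup X) : (foxHom j w).right = w := by
  have h : (SemidirectProduct.rightHom.comp (foxHom j)) = MonoidHom.id (FreeGroup X) := by
    ext i
    simp [foxHom]
  exact DFunLike.congr_fun h w

theorem foxDeriv_of (i j : X) :
    foxDeriv (FreeGroup.of i) j = if i = j then 1 else 0 := by
  simp [foxDeriv, foxHom]

theorem foxDeriv_mul (v w : FreeGroup X) (j : X) :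
    foxDeriv (v * w) j = foxDeriv v j + MonoidAlgebra.of ℤ (FreeGroup X) v * foxDeriv w j := by
  simp only [foxDeriv, map_mul, SemidirectProduct.mul_left, toAdd_mul, foxHom_right]
  rfl

end Fox

/-! ### Twisted Alexander polynomials of a finitely presented group

A presentation is given by a finite type `X` of generators and a finite family `r : I → F(X)` of
relators; the presented group is `PresentedGroup (Set.range r)`. -/

namespace TwistedAlexander

variable {X I : Type*} [Fintype X] [DecidableEq X] {R : Type*} [CommRing R] {m n : ℕ}
  (r : I → FreeGroup X)
  (α : PresentedGroup (Set.range r) →* Multiplicative (Fin m → ℤ))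
  (ρ : PresentedGroup (Set.range r) →* Matrix.GeneralLinearGroup (Fin n) R)

/-- `ρ ⊗ α : Γ → M_n(R[t₁^{±1}, …, t_m^{±1}])`, `g ↦ α(g) ρ(g)`. -/
noncomputable def tensorHom :
    PresentedGroup (Set.range r) →* Matrix (Fin n) (Fin n) (LaurentRing R m) where
  toFun g := LaurentRing.monomial R (α g) •
    ((ρ g : Matrix (Fin n) (Fin n) R).map (LaurentRing.const (m := m)))
  map_one' := by simp
  map_mul' a b := by simp [Matrix.map_mul, smul_smul, mul_comm (LaurentRing.monomial R (α a))]

/-- `Ω : ℤF → M_n(R[t₁^{±1}, …, t_m^{±1}])`, the ring homomorphism induced by `F → Γ` and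
`ρ ⊗ α`. -/
noncomputable def Omega :
    MonoidAlgebra ℤ (FreeGroup X) →ₐ[ℤ] Matrix (Fin n) (Fin n) (LaurentRing R m) :=
  MonoidAlgebra.lift ℤ (Matrix (Fin n) (Fin n) (LaurentRing R m)) (FreeGroup X)
    ((tensorHom r α ρ).comp (PresentedGroup.mk (Set.range r)))

/-- The twisted presentation matrix `Ω(∂rᵢ/∂xⱼ)`, a block matrix with blocks of size `n × n`. -/
noncomputable def presMatrix : Matrix (I × Fin n) (X × Fin n) (LaurentRing R m) :=
  fun i j => Omega r α ρ (foxDeriv (r i.1) j.1) i.2 j.2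

/-- The presentation matrix with the block column of the generator `j` removed. -/
noncomputable def presMatrixDel (j : X) :
    Matrix (I × Fin n) ({x : X // x ≠ j} × Fin n) (LaurentRing R m) :=
  (presMatrix r α ρ).submatrix id (Prod.map Subtype.val id)

/-- `det Ω(1 - xⱼ)`. -/
noncomputable def denom (j : X) : LaurentRing R m :=
  (Omega r α ρ (1 - MonoidAlgebra.of ℤ (FreeGroup X) (FreeGroup.of j))).det

/-- The maximal minors of the presentation matrix with the `j`-th block column removed. The order
in which the rows are listed affects the sign of a minor only. -/
def minors (j : X) : Set (LaurentRing R m) :=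
  Set.range fun rows : ({x : X // x ≠ j} × Fin n) ↪ (I × Fin n) =>
    ((presMatrixDel r α ρ j).submatrix rows id).det

/-- `Q` is a greatest common divisor of the set `S` (with `Q = 0` if `S` is empty or `{0}`). -/
def IsGCDOf {A : Type*} [CommRing A] (S : Set A) (Q : A) : Prop :=
  (∀ x ∈ S, Q ∣ x) ∧ ∀ d, (∀ x ∈ S, d ∣ x) → d ∣ Q

/-- The Laurent polynomial `Δ` is a value of the twisted Alexander polynomial
`gcd {maximal minors} / det Ω(1 - xⱼ)` of the presentation, for some `j` for which the
denominator is nonzero and some choice of the gcd. -/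
def IsTwistedAlexander (Δ : LaurentRing R m) : Prop :=
  ∃ j : X, denom r α ρ j ≠ 0 ∧ ∃ Q, IsGCDOf (minors r α ρ j) Q ∧ Δ * denom r α ρ j = Q

/-- The finer version for presentations with one generator more than relators: the matrix with the
`j`-th block column removed is then square, and its determinant is taken for the gcd. The
bijection `e` lists the relators in some order. -/
def IsNormalizedTwistedAlexander (Δ : LaurentRing R m) : Prop :=
  ∃ j : X, denom r α ρ j ≠ 0 ∧ ∃ e : {x : X // x ≠ j} ≃ I,
    Δ * denom r α ρ j = ((presMatrixDel r α ρ j).submatrix (Prod.map e id) id).det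

end TwistedAlexander

/-! ### Virtual link diagrams -/

/-- The two sides, as seen when looking along the strands of a crossing. -/
inductive Side
  | left
  | right
  deriving DecidableEq

instance : Fintype Side := ⟨{Side.left, Side.right}, fun x => by cases x <;> simp⟩

/-- The three kinds of double points of an oriented virtual link diagram. -/
inductive CrossingKind
  | positive
  | negative
  | virtual

/-- The combinatorial data of a generic immersion of oriented circles in an oriented surface.
Every double point is drawn with both strands pointing upwards. It has two incoming slots, at the
bottom left and the bottom right, and two outgoing slots, at the top left and the top right; one
strand runs from bottom left to top right, the other one from bottom right to top left.
`next` sends the outgoing slot at which a short arc starts to the incoming slot at which it ends.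
`numCircles` counts the components without double points. -/
structure OrientedShadow where
  numCrossings : ℕ
  next : Fin numCrossings × Side ≃ Fin numCrossings × Side
  numCircles : ℕ

namespace OrientedShadow

variable (D : OrientedShadow)

/-- A slot (incoming or outgoing) of a double point. Outgoing slots are in bijection with the short
arcs that start there. -/
abbrev Slot : Type := Fin D.numCrossings × Side

/-- The ends of the short arcs: `inl` for the outgoing slots, `inr` for the incoming ones. -/
abbrev Dart : Type := D.Slot ⊕ D.Slot

/-- The next dart around the same double point, counterclockwise. -/
def rot : D.Dart → D.Dart
  | Sum.inl (c, Side.right) => Sum.inl (c, Side.left)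
  | Sum.inl (c, Side.left) => Sum.inr (c, Side.left)
  | Sum.inr (c, Side.left) => Sum.inr (c, Side.right)
  | Sum.inr (c, Side.right) => Sum.inl (c, Side.right)

/-- The other end of the same short arc. -/
def opp : D.Dart → D.Dart
  | Sum.inl a => Sum.inr (D.next a)
  | Sum.inr b => Sum.inl (D.next.symm b)

/-- The number of faces: orbits of the permutation `rot ∘ opp` of the darts. -/
noncomputable def numFaces : ℕ :=
  Nat.card (Quot fun d d' : D.Dart => d' = D.rot (D.opp d))

/-- The number of connected components of the 4-valent graph formed by the double points and the
short arcs. -/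
noncomputable def numComponents : ℕ :=
  Nat.card (Quot fun c c' : Fin D.numCrossings => ∃ a b, D.next (c, a) = (c', b))

/-- The immersion can be drawn in the plane (equivalently, on the sphere): Euler's formula
`V - E + F = 2 C` for the 4-valent graph, where `E = 2 V`; this says that each of its connected
components has genus zero. -/
def IsPlanar : Prop :=
  D.numCrossings + D.numFaces = 2 * D.numCrossings + 2 * D.numComponents

end OrientedShadow

/-- An oriented virtual link diagram: a generic immersion of oriented circles in the plane, each
double point being a positive, a negative, or a virtual crossing. -/
structure VirtualLinkDiagram extends OrientedShadow where
  kind : Fin numCrossings → CrossingKind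
  planar : toOrientedShadow.IsPlanar

/-- The two auxiliary generators of the virtual knot group. -/
inductive Aux
  | s
  | q
  deriving DecidableEq

instance : Fintype Aux := ⟨{Aux.s, Aux.q}, fun x => by cases x <;> simp⟩

namespace VirtualLinkDiagram

variable (D : VirtualLinkDiagram)

/-- The short arcs of the diagram: those that start at a crossing (labelled by the outgoing slot)
and the components without crossings. -/
abbrev ShortArc : Type := D.Slot ⊕ Fin D.numCircles

/-- The generators of the virtual knot group: the short arcs, and `s`, `q`. -/
abbrev Gen : Type := D.ShortArc ⊕ Aux

/-- The generator of the short arc that leaves the crossing `c` on the given side. -/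
def outArc (c : Fin D.numCrossings) (x : Side) : FreeGroup D.Gen :=
  FreeGroup.of (Sum.inl (Sum.inl (c, x)))

/-- The generator of the short arc that enters the crossing `c` on the given side. -/
def inArc (c : Fin D.numCrossings) (x : Side) : FreeGroup D.Gen :=
  FreeGroup.of (Sum.inl (Sum.inl (D.next.symm (c, x))))

/-- The generator `s`. -/
def gs : FreeGroup D.Gen := FreeGroup.of (Sum.inr Aux.s)

/-- The generator `q`. -/
def gq : FreeGroup D.Gen := FreeGroup.of (Sum.inr Aux.q)

/-- The right-hand sides of the two relations at the crossing `c`, which express the outgoing arc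
on the given side by the incoming arcs. At a positive crossing the strand that runs from left to
right is the overcrossing strand, at a negative crossing it is the other one. -/
def crossingWord (c : Fin D.numCrossings) (x : Side) : FreeGroup D.Gen :=
  let a := D.inArc c Side.left
  let b := D.inArc c Side.right
  let s := D.gs
  let q := D.gq
  match D.kind c, x with
  | CrossingKind.positive, Side.right => s * a * s⁻¹
  | CrossingKind.positive, Side.left => a * b * (s * a⁻¹ * s⁻¹)
  | CrossingKind.negative, Side.left => s⁻¹ * b * s
  | CrossingKind.negative, Side.right => (s⁻¹ * b⁻¹ * s) * a * b
  | CrossingKind.virtual, Side.right => q * a * q⁻¹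
  | CrossingKind.virtual, Side.left => q⁻¹ * b * q

/-- The relators of the Wirtinger-like presentation, one for each short arc and one more:
the two relators of each crossing, indexed by the outgoing arcs; the trivial relator for a component
without crossings; and the commutator `[s, q]`. -/
def relator : D.ShortArc ⊕ Unit → FreeGroup D.Gen
  | Sum.inl (Sum.inl (c, x)) => D.crossingWord c x * (D.outArc c x)⁻¹
  | Sum.inl (Sum.inr _) => 1
  | Sum.inr _ => D.gs * D.gq * D.gs⁻¹ * D.gq⁻¹

/-- The virtual knot group `VG`. -/
abbrev VG : Type := PresentedGroup (Set.range D.relator)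

/-- `s ↦ s`, `q ↦ q`, and every short arc `↦ t`, where `s`, `t`, `q` are the standard generators
of `ℤ³`, in this order. -/
def abelGen : D.Gen → Multiplicative (Fin 3 → ℤ)
  | Sum.inl _ => Multiplicative.ofAdd (Pi.single 1 1)
  | Sum.inr Aux.s => Multiplicative.ofAdd (Pi.single 0 1)
  | Sum.inr Aux.q => Multiplicative.ofAdd (Pi.single 2 1)

theorem abelGen_relator (w : FreeGroup D.Gen) (hw : w ∈ Set.range D.relator) :
    FreeGroup.lift D.abelGen w = 1 := by
  obtain ⟨i, rfl⟩ := hw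
  rcases i with (⟨c, x⟩ | _) | _
  · have h : FreeGroup.lift D.abelGen (D.crossingWord c x) =
        Multiplicative.ofAdd (Pi.single 1 1) := by
      rcases hk : D.kind c <;> cases x <;>
        simp [crossingWord, hk, inArc, gs, gq, abelGen, mul_comm, mul_left_comm, mul_assoc]
    simp [relator, h, outArc, abelGen]
  · simp [relator]
  · simp [relator, gs, gq, mul_comm, mul_assoc]

/-- The homomorphism `α : VG → ℤ³`. -/
def alpha : D.VG →* Multiplicative (Fin 3 → ℤ) :=
  PresentedGroup.toGroup (f := D.abelGen) D.abelGen_relator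

variable {R : Type*} [CommRing R] {n : ℕ}

/-- `H` is a value of the twisted virtual Alexander polynomial `H^ρ(s,t,q)`, the twisted Alexander
polynomial of `(VG, α, ρ)`, which is defined up to units of `R[s^{±1},t^{±1},q^{±1}]`. -/
def IsTwistedVirtualAlexander (ρ : D.VG →* Matrix.GeneralLinearGroup (Fin n) R)
    (H : LaurentRing R 3) : Prop :=
  TwistedAlexander.IsTwistedAlexander D.relator D.alpha ρ H

/-- `H` is a value of the twisted virtual Alexander polynomial in the finer sense, defined up to
the smaller indeterminacy `EqUpToIndeterminacy`. -/
def IsNormalizedTwistedVirtualAlexander (ρ : D.VG →* Matrix.GeneralLinearGroup (Fin n) R)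
    (H : LaurentRing R 3) : Prop :=
  TwistedAlexander.IsNormalizedTwistedAlexander D.relator D.alpha ρ H

/-- Equality up to the indeterminacy of the twisted virtual Alexander polynomial: a factor
`ε (s^{e₁} t^{e₂} q^{e₃})^n` with `ε` a unit of `R`, and if `ρ` is unimodular, even a factor
`± (s^{e₁} t^{e₂} q^{e₃})^n`, with sign `+` if `n` is even. -/
def EqUpToIndeterminacy (ρ : D.VG →* Matrix.GeneralLinearGroup (Fin n) R)
    (f g : LaurentRing R 3) : Prop :=
  (∃ (ε : Rˣ) (e : Multiplicative (Fin 3 → ℤ)),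
    f = LaurentRing.const (ε : R) * LaurentRing.monomial R e ^ n * g) ∧
  ((∀ x, (ρ x : Matrix (Fin n) (Fin n) R).det = 1) →
    ∃ (k : ℕ) (e : Multiplicative (Fin 3 → ℤ)),
      f = ((-1) ^ k) ^ n * LaurentRing.monomial R e ^ n * g)

end VirtualLinkDiagram

/-- The substitution `H(s, t, q) ↦ H(s q⁻¹, t q, 1)`. -/
noncomputable def substSTQ {R : Type*} [CommRing R] (H : LaurentRing R 3) : LaurentRing R 3 :=
  LaurentRing.eval
    ![LaurentRing.var R 0 * (LaurentRing.var R 2)⁻¹, LaurentRing.var R 1 * LaurentRing.var R 2, 1] H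

/-! Delete the block column of `q`. The relator `[s,q]` has no derivatives in the short arcs, and
its `s`-derivative has the image of `1 - q`, which is the denominator. Hence the quotient is the
Laurent polynomial `det (arcMatrix)`, built from the arc relators and the arcs alone (`detDel_gq`).
By the fundamental formula of Fox calculus, deleting another column changes the quotient only by
`(±1)^n` (`Matrix.det_delete_blockCol`). With one generator more than relators, all maximal minors
agree up to sign, so every gcd value is associated to this determinant.

It remains to see that the substitution fixes the determinant. Give `s`, `t`, `q` the weights `1,
-1, 1`. Then `s q⁻¹` and `t q` have weight zero, and the substitution multiplies a monomial of
weight `w` by `q^{-w}`. A planar diagram has an Alexander numbering `l` of its short arcs, and the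
entry of `arcMatrix` at the relator of `y` and the arc `x` is homogeneous of weight `l y - l x`
(`hasHomogeneousDeriv_relator`). So the substitution conjugates the matrix by a diagonal matrix of
powers of `q`.

The numbering is cohomological: on a planar shadow every cycle is the coboundary of a function on
the faces, by Euler's formula (`range_faceDiff`). The sum of all oriented arcs is a cycle, which
yields a face function jumping by one across each arc. -/

/-! ### Alexander numberings of planar shadows -/

namespace OrientedShadow

variable (D : OrientedShadow)

/-- The faces: orbits of the permutation `rot ∘ opp` of the darts. -/
abbrev Face : Type := Quot fun d d' : D.Dart => d' = D.rot (D.opp d)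

/-- The connected components of the underlying 4-valent graph. -/
abbrev Component : Type :=
  Quot fun c c' : Fin D.numCrossings => ∃ a b, D.next (c, a) = (c', b)

/-- The face to the right of a dart. -/
def face (d : D.Dart) : D.Face := Quot.mk _ d

theorem opp_opp (d : D.Dart) : D.opp (D.opp d) = d := by
  cases d <;> simp [opp]

/-- The coboundary of a function on the faces: the difference of its values on the two sides of
each arc. -/
noncomputable def faceDiff : (D.Face → ℚ) →ₗ[ℚ] (D.Slot → ℚ) where
  toFun g a := g (D.face (Sum.inl a)) - g (D.face (Sum.inr (D.next a)))
  map_add' g h := by ext; simp only [Pi.add_apply]; ring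
  map_smul' c g := by ext; simp only [Pi.smul_apply, smul_eq_mul, RingHom.id_apply]; ring

/-- The incidence matrix of the 4-valent graph. -/
def incidence : Matrix D.Slot (Fin D.numCrossings) ℚ :=
  fun a c => (if (D.next a).1 = c then 1 else 0) - (if a.1 = c then 1 else 0)

/-- The quadrant between `d` and the next dart counterclockwise lies to the left of `d`, that is, to
the right of its opposite end. -/
theorem face_opp (g : D.Face → ℚ) (d : D.Dart) :
    g (D.face (D.opp d)) = g (D.face (D.rot d)) := by
  have h : D.face (D.opp d) = D.face (D.rot (D.opp (D.opp d))) := Quot.sound rfl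
  rw [h, opp_opp]

theorem face_next (g : D.Face → ℚ) (a : D.Slot) :
    g (D.face (Sum.inr (D.next a))) = g (D.face (D.rot (Sum.inl a))) :=
  D.face_opp g (Sum.inl a)

theorem face_next_symm (g : D.Face → ℚ) (b : D.Slot) :
    g (D.face (Sum.inl (D.next.symm b))) = g (D.face (D.rot (Sum.inr b))) :=
  D.face_opp g (Sum.inr b)

theorem rot_outRight (c : Fin D.numCrossings) :
    D.rot (Sum.inl (c, Side.right)) = Sum.inl (c, Side.left) := rfl

theorem rot_outLeft (c : Fin D.numCrossings) :
    D.rot (Sum.inl (c, Side.left)) = Sum.inr (c, Side.left) := rfl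

theorem rot_inLeft (c : Fin D.numCrossings) :
    D.rot (Sum.inr (c, Side.left)) = Sum.inr (c, Side.right) := rfl

theorem rot_inRight (c : Fin D.numCrossings) :
    D.rot (Sum.inr (c, Side.right)) = Sum.inl (c, Side.right) := rfl

theorem sum_side {M : Type*} [AddCommMonoid M] (f : Side → M) :
    ∑ x, f x = f Side.left + f Side.right := by
  rw [show (Finset.univ : Finset Side) = {Side.left, Side.right} from rfl,
    Finset.sum_pair (by decide)]

theorem incidence_transpose_mulVec (v : D.Slot → ℚ) (c : Fin D.numCrossings) :
    (D.incidence.transpose.mulVec v) c =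
      (v (D.next.symm (c, Side.left)) + v (D.next.symm (c, Side.right))) -
        (v (c, Side.left) + v (c, Side.right)) := by
  have key (w : D.Slot → ℚ) :
      ∑ a : D.Slot, (if a.1 = c then w a else 0) = w (c, Side.left) + w (c, Side.right) := by
    rw [Fintype.sum_prod_type, Finset.sum_eq_single c] <;> simp +contextual [sum_side]
  simp only [Matrix.mulVec, dotProduct, Matrix.transpose_apply, incidence, sub_mul, ite_mul,
    one_mul, zero_mul, Finset.sum_sub_distrib]
  rw [key v, ← key fun b => v (D.next.symm b),
    ← Equiv.sum_comp D.next fun b => if b.1 = c then v (D.next.symm b) else 0]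
  simp

/-- The differences across the four darts at a crossing telescope around its four quadrants. -/
theorem incidence_transpose_faceDiff (g : D.Face → ℚ) :
    D.incidence.transpose.mulVec (D.faceDiff g) = 0 := by
  ext c
  rw [incidence_transpose_mulVec]
  simp only [faceDiff, LinearMap.coe_mk, AddHom.coe_mk, Equiv.apply_symm_apply, Pi.zero_apply]
  rw [D.face_next g, D.face_next g, D.face_next_symm g, D.face_next_symm g, rot_outLeft,
    rot_outRight, rot_inLeft, rot_inRight]
  ring

/-- Two arcs enter each crossing and two leave it. -/
theorem incidence_transpose_one : D.incidence.transpose.mulVec 1 = 0 := by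
  ext c
  simp [incidence_transpose_mulVec]

/-! ### Dimension count from Euler's formula -/

theorem eq_of_component {A : Type*} (h : Fin D.numCrossings → A)
    (hh : ∀ a : D.Slot, h (D.next a).1 = h a.1) {c c' : Fin D.numCrossings}
    (e : (Quot.mk _ c : D.Component) = Quot.mk _ c') : h c = h c' := by
  have : ∀ x y : Fin D.numCrossings, (∃ a b, D.next (x, a) = (y, b)) → h x = h y := by
    rintro x y ⟨a, b, hab⟩
    have := hh (x, a)
    rw [hab] at this
    exact this.symm
  exact congrArg (Quot.lift h this) e

/-- A function in the kernel is constant on components, so its values at one crossing of each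
component determine it. -/
theorem finrank_ker_incidence :
    Module.finrank ℚ (LinearMap.ker D.incidence.mulVecLin) ≤ D.numComponents := by
  classical
  let s : (D.Component → Fin D.numCrossings) := Quot.out
  let f : LinearMap.ker D.incidence.mulVecLin →ₗ[ℚ] (D.Component → ℚ) :=
    (LinearMap.funLeft ℚ ℚ s).comp (Submodule.subtype _)
  have : Fintype D.Component := Fintype.ofFinite _
  have hf : Function.Injective f := by
    rw [← LinearMap.ker_eq_bot, LinearMap.ker_eq_bot']
    rintro ⟨h, hh⟩ h0
    have hh' : ∀ a : D.Slot, h (D.next a).1 = h a.1 := fun a => by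
      have := congrFun (LinearMap.mem_ker.1 hh) a
      simpa [Matrix.mulVec, dotProduct, incidence, sub_mul, Finset.sum_sub_distrib,
        sub_eq_zero] using this
    ext c
    have h1 : h c = h (s (Quot.mk _ c)) :=
      D.eq_of_component h hh' (Quot.out_eq _).symm
    have h2 := congrFun h0 (Quot.mk _ c)
    simp only [Pi.zero_apply] at h2
    exact h1.trans h2
  have := LinearMap.finrank_le_finrank_of_injective hf
  rwa [Module.finrank_pi, ← Nat.card_eq_fintype_card] at this

/-- A face function without jumps takes a single value on the four quadrants of a crossing and keeps
it along arcs, so one value per component determines it. -/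
theorem finrank_ker_faceDiff :
    Module.finrank ℚ (LinearMap.ker D.faceDiff) ≤ D.numComponents := by
  classical
  let s : (D.Component → Fin D.numCrossings) := Quot.out
  let f : LinearMap.ker D.faceDiff →ₗ[ℚ] (D.Component → ℚ) :=
    (LinearMap.funLeft ℚ ℚ fun x => D.face (Sum.inl (s x, Side.left))).comp
      (Submodule.subtype _)
  have : Fintype D.Component := Fintype.ofFinite _
  have hf : Function.Injective f := by
    rw [← LinearMap.ker_eq_bot, LinearMap.ker_eq_bot']
    rintro ⟨g, hg⟩ h0
    have hg' : ∀ a : D.Slot,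
        g (D.face (Sum.inl a)) = g (D.face (Sum.inr (D.next a))) := fun a =>
      sub_eq_zero.1 (congrFun (LinearMap.mem_ker.1 hg) a)
    have hr : ∀ a, g (D.face (Sum.inl a)) = g (D.face (D.rot (Sum.inl a))) :=
      fun a => (hg' a).trans (D.face_next g a)
    have hi : ∀ b, g (D.face (Sum.inr b)) = g (D.face (D.rot (Sum.inr b))) := fun b => by
      have := hg' (D.next.symm b)
      rw [D.face_next_symm g, Equiv.apply_symm_apply] at this
      exact this.symm
    have hrot : ∀ c x, g (D.face (Sum.inl (c, x))) = g (D.face (Sum.inl (c, Side.left))) ∧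
        g (D.face (Sum.inr (c, x))) = g (D.face (Sum.inl (c, Side.left))) := fun c x => by
      have h1 := hr (c, Side.right)
      have h2 := hr (c, Side.left)
      have h3 := hi (c, Side.left)
      rw [rot_outRight] at h1
      rw [rot_outLeft] at h2
      rw [rot_inLeft] at h3
      cases x <;> constructor <;> simp [h1, h2, h3]
    have hc {c c' : Fin D.numCrossings} := D.eq_of_component (c := c) (c' := c') (fun c => g (D.face (Sum.inl (c, Side.left))))
      (fun a => by
        rw [← (hrot a.1 a.2).1, ← (hrot (D.next a).1 (D.next a).2).2]
        exact (hg' a).symm)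
    have h1 : ∀ c, g (D.face (Sum.inl (c, Side.left))) = 0 := fun c => by
      refine Eq.trans ?_ (congrFun h0 (Quot.mk _ c))
      exact hc (Quot.out_eq _).symm
    ext x
    induction x using Quot.ind with
    | mk d =>
      rcases d with ⟨c, x⟩ | ⟨c, x⟩
      · exact (hrot c x).1.trans (h1 c)
      · exact (hrot c x).2.trans (h1 c)
  have := LinearMap.finrank_le_finrank_of_injective hf
  rwa [Module.finrank_pi, ← Nat.card_eq_fintype_card] at this

/-- Coboundaries are cycles, and the dimensions match: the range has dimension at least `F - C`, the
cycle space at most `2V - (V - C) = V + C`, and planarity says `F = V + 2C`. -/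
theorem range_faceDiff (h : D.IsPlanar) :
    LinearMap.range D.faceDiff = LinearMap.ker D.incidence.transpose.mulVecLin := by
  classical
  have : Fintype D.Face := Fintype.ofFinite _
  apply Submodule.eq_of_le_of_finrank_le
  · rintro _ ⟨g, rfl⟩
    exact D.incidence_transpose_faceDiff g
  · have h1 := LinearMap.finrank_range_add_finrank_ker D.faceDiff
    have h2 := LinearMap.finrank_range_add_finrank_ker D.incidence.mulVecLin
    have h3 := LinearMap.finrank_range_add_finrank_ker D.incidence.transpose.mulVecLin
    have h4 : Module.finrank ℚ (LinearMap.range D.incidence.transpose.mulVecLin) =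
      Module.finrank ℚ (LinearMap.range D.incidence.mulVecLin) := Matrix.rank_transpose _
    have h5 := D.finrank_ker_incidence
    have h6 := D.finrank_ker_faceDiff
    have h7 : D.numFaces = Fintype.card D.Face := Nat.card_eq_fintype_card
    have h8 : Fintype.card Side = 2 := rfl
    rw [Module.finrank_pi] at h1 h2 h3
    rw [Fintype.card_prod, Fintype.card_fin, h8] at h3
    rw [Fintype.card_fin] at h2
    unfold IsPlanar at h
    omega

/-- A planar shadow has an Alexander numbering. -/
theorem exists_numbering (h : D.IsPlanar) : ∃ l : D.Slot → ℤ, ∀ c,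
    l (c, Side.right) = l (c, Side.left) + 1 ∧
    l (D.next.symm (c, Side.left)) = l (c, Side.left) ∧
    l (D.next.symm (c, Side.right)) = l (c, Side.left) + 1 := by
  have h1 : (1 : D.Slot → ℚ) ∈ LinearMap.range D.faceDiff := by
    rw [D.range_faceDiff h]
    exact D.incidence_transpose_one
  obtain ⟨g, hg⟩ := h1
  have hg' : ∀ a : D.Slot,
      g (D.face (Sum.inl a)) = g (D.face (Sum.inr (D.next a))) + 1 := fun a => by
    have := congrFun hg a
    simp only [faceDiff, LinearMap.coe_mk, AddHom.coe_mk, Pi.one_apply] at this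
    linarith
  -- An arc is numbered by the face on its left. Rational values of `g` suffice: all jumps are
  -- exactly one, and the floor commutes with adding one.
  refine ⟨fun a => ⌊g (D.face (Sum.inr (D.next a)))⌋, fun c => ?_⟩
  have h2 := hg' (c, Side.left)
  have h3 := hg' (D.next.symm (c, Side.left))
  rw [D.face_next g, rot_outLeft] at h2
  rw [D.face_next_symm g, Equiv.apply_symm_apply, rot_inLeft] at h3
  dsimp only
  rw [D.face_next g, D.face_next g, rot_outLeft, rot_outRight, Equiv.apply_symm_apply,
    Equiv.apply_symm_apply, h2, h3, Int.floor_add_one]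
  exact ⟨rfl, rfl, rfl⟩

end OrientedShadow
/-! ### Fox calculus -/

section Fox

variable {X : Type*} [DecidableEq X]

theorem foxDeriv_one (j : X) : foxDeriv (1 : FreeGroup X) j = 0 := by
  have h := foxDeriv_mul (1 : FreeGroup X) 1 j
  rwa [mul_one, map_one, one_mul, left_eq_add] at h

theorem foxDeriv_inv (w : FreeGroup X) (j : X) :
    foxDeriv w⁻¹ j = -(MonoidAlgebra.of ℤ (FreeGroup X) w⁻¹ * foxDeriv w j) := by
  have h := foxDeriv_mul w⁻¹ w j
  rw [inv_mul_cancel, foxDeriv_one] at h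
  exact eq_neg_of_add_eq_zero_left h.symm

/-- The fundamental formula of the Fox calculus. -/
theorem sum_foxDeriv_mul [Fintype X] (w : FreeGroup X) :
    ∑ j, foxDeriv w j * (MonoidAlgebra.of ℤ (FreeGroup X) (FreeGroup.of j) - 1) =
      MonoidAlgebra.of ℤ (FreeGroup X) w - 1 := by
  have hinv (w : FreeGroup X)
      (h : ∑ j, foxDeriv w j * (MonoidAlgebra.of ℤ (FreeGroup X) (FreeGroup.of j) - 1) =
        MonoidAlgebra.of ℤ (FreeGroup X) w - 1) :
      ∑ j, foxDeriv w⁻¹ j * (MonoidAlgebra.of ℤ (FreeGroup X) (FreeGroup.of j) - 1) =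
        MonoidAlgebra.of ℤ (FreeGroup X) w⁻¹ - 1 := by
    simp only [foxDeriv_inv, neg_mul, mul_assoc, Finset.sum_neg_distrib, ← Finset.mul_sum]
    rw [h, mul_sub, ← map_mul, inv_mul_cancel, map_one, mul_one, neg_sub]
  induction w using FreeGroup.induction_on with
  | C1 => simp only [foxDeriv_one, zero_mul, Finset.sum_const_zero, map_one, sub_self]
  | of x => simp [foxDeriv_of]
  | inv_of x h => exact hinv _ h
  | mul x y hx hy =>
    simp only [foxDeriv_mul, add_mul, mul_assoc, Finset.sum_add_distrib, ← Finset.mul_sum]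
    rw [hx, hy, map_mul]
    noncomm_ring

end Fox

/-! ### Determinants of block matrices -/

namespace Matrix

variable {A I Y : Type*} [CommRing A] [Fintype Y] [DecidableEq Y]

/-- Listing the block rows in a different order changes the determinant by `(±1)^n`. -/
theorem det_submatrix_prodMap_equiv {n : ℕ} (M : Matrix (I × Fin n) (Y × Fin n) A)
    (e e' : Y ≃ I) : ∃ k : ℕ, (M.submatrix (Prod.map e id) id).det =
      ((-1) ^ k) ^ n * (M.submatrix (Prod.map e' id) id).det := by
  have h : M.submatrix (Prod.map e id) id = (M.submatrix (Prod.map e' id) id).submatrix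
      (Equiv.prodCongrLeft fun _ : Fin n => e.trans e'.symm) id := by
    ext ⟨i, a⟩ j
    simp
  rw [h, det_permute, Equiv.Perm.sign_prodCongrLeft]
  rcases Int.units_eq_one_or (Equiv.Perm.sign (e.trans e'.symm)) with hs | hs
  · exact ⟨0, by simp [hs]⟩
  · exact ⟨1, by simp [hs]⟩

/-- All minors of maximal size of a square matrix are equal up to sign. -/
theorem det_submatrix_embedding [Fintype I] (M : Matrix I Y A) (e : Y ≃ I) (f : Y ↪ I) :
    ∃ u : Aˣ, (M.submatrix f id).det = u * (M.submatrix e id).det := by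
  have hf : Function.Bijective f :=
    (Fintype.bijective_iff_injective_and_card f).2 ⟨f.injective, Fintype.card_congr e⟩
  have h : M.submatrix f id = (M.submatrix e id).submatrix
      ((Equiv.ofBijective f hf).trans e.symm) id := by
    ext i j
    simp
  rw [h, det_permute]
  exact ⟨Units.map (Int.castRingHom A : ℤ →* A)
    (Equiv.Perm.sign ((Equiv.ofBijective f hf).trans e.symm)), rfl⟩

/-- The identity matrix with one block column replaced by `w`. -/
def oneUpdateBlockCol {n : ℕ} (i₀ : Y) (w : Y → Matrix (Fin n) (Fin n) A) :
    Matrix (Y × Fin n) (Y × Fin n) A :=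
  fun k l => if l.1 = i₀ then w k.1 k.2 l.2 else (1 : Matrix (Y × Fin n) (Y × Fin n) A) k l

theorem det_oneUpdateBlockCol {n : ℕ} (i₀ : Y) (w : Y → Matrix (Fin n) (Fin n) A) :
    (oneUpdateBlockCol i₀ w).det = (w i₀).det := by
  rw [twoBlockTriangular_det (oneUpdateBlockCol i₀ w) fun k => k.1 ≠ i₀]
  · have h1 : toSquareBlockProp (oneUpdateBlockCol i₀ w) (fun k => k.1 ≠ i₀) = 1 := by
      ext ⟨k, hk⟩ ⟨l, hl⟩
      simp [toSquareBlockProp, oneUpdateBlockCol, hl, one_apply]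
    let f : Fin n ≃ {k : Y × Fin n // ¬ k.1 ≠ i₀} :=
      { toFun := fun a => ⟨(i₀, a), by simp⟩
        invFun := fun k => k.1.2
        left_inv := fun a => rfl
        right_inv := fun ⟨⟨k, a⟩, hk⟩ => by
          obtain rfl : k = i₀ := not_not.1 hk
          rfl }
    rw [h1, det_one, one_mul, ← det_submatrix_equiv_self f]
    congr 1
    ext a b
    simp [toSquareBlockProp, oneUpdateBlockCol, f]
  · rintro ⟨k, a⟩ hk ⟨l, b⟩ hl
    have hkl : k ≠ l := fun h => hk (h ▸ hl)
    simp [oneUpdateBlockCol, show l ≠ i₀ from hl, hkl]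

theorem mul_oneUpdateBlockCol {J : Type*} {n : ℕ} (i₀ : Y) (w : Y → Matrix (Fin n) (Fin n) A)
    (M : Matrix J (Y × Fin n) A) (r : J) (l : Y × Fin n) :
    (M * oneUpdateBlockCol i₀ w) r l =
      if l.1 = i₀ then ∑ k, ∑ a, M r (k, a) * w k a l.2 else M r l := by
  rw [mul_apply]
  split_ifs with h
  · simp [oneUpdateBlockCol, h, Fintype.sum_prod_type]
  · simp [oneUpdateBlockCol, h, one_apply]

variable {X : Type*} [Fintype X] [DecidableEq X]

/-- If the block columns of `M` satisfy the linear relation with coefficients `v`, then deleting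
different block columns gives proportional determinants. -/
theorem det_delete_blockCol {n : ℕ} (M : Matrix (I × Fin n) (X × Fin n) A)
    (v : X → Matrix (Fin n) (Fin n) A) (hv : ∀ r b, ∑ x, ∑ a, M r (x, a) * v x a b = 0)
    {i j : X} (e : {x // x ≠ j} ≃ I) (e' : {x // x ≠ i} ≃ I) : ∃ k : ℕ,
      (M.submatrix (Prod.map e id) (Prod.map Subtype.val id)).det * (v i).det =
        ((-1) ^ k) ^ n *
          ((M.submatrix (Prod.map e' id) (Prod.map Subtype.val id)).det * (v j).det) := by
  by_cases hij : i = j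
  · subst hij
    obtain ⟨k, hk⟩ := det_submatrix_prodMap_equiv
      (M.submatrix id (Prod.map (Subtype.val : {x // x ≠ i} → X) id)) e e'
    refine ⟨k, ?_⟩
    rw [← mul_assoc]
    exact congrArg (· * (v i).det) hk
  let τ : {x // x ≠ j} ≃ {x // x ≠ i} := (Equiv.swap i j).subtypeEquiv fun x => by
    rw [not_iff_not, Equiv.swap_apply_eq_iff, Equiv.swap_apply_left]
  let i₀ : {x // x ≠ j} := ⟨i, hij⟩
  have hτ : ∀ l : {x // x ≠ j}, l ≠ i₀ → (τ l : X) = l := fun l hl =>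
    Equiv.swap_apply_of_ne_of_ne (fun h => hl (Subtype.ext h)) l.2
  have hτ₀ : (τ i₀ : X) = j := Equiv.swap_apply_left i j
  let P := M.submatrix (Prod.map e id) (Prod.map (Subtype.val : {x // x ≠ j} → X) id)
  let P' := M.submatrix (Prod.map e id) (Prod.map (Subtype.val ∘ τ) (id : Fin n → Fin n))
  -- Both sides replace block column `i` by `∑ M_k v_k` over `k ≠ j`, which is `-M_j v_j` by the
  -- linear relation. Taking determinants produces the factors `det (v i)` and `(-1)^n det (v j)`.
  have h1 : P * oneUpdateBlockCol i₀ (fun k => v k) =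
      P' * oneUpdateBlockCol i₀ (fun k => if k = i₀ then -v j else 0) := by
    ext r ⟨l, b⟩
    rw [mul_oneUpdateBlockCol, mul_oneUpdateBlockCol]
    split_ifs with h
    · have h2 := hv (Prod.map e id r) b
      rw [Fintype.sum_eq_add_sum_subtype_ne _ j] at h2
      have h3 : ∑ k, ∑ a, P' r (k, a) * (if k = i₀ then -v j else 0 : Matrix _ _ A) a b =
          -∑ a, M (Prod.map e id r) (j, a) * v j a b := by
        rw [Finset.sum_eq_single i₀ (fun k _ hk => by simp [hk]) (by simp)]
        simp [P', hτ₀]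
      exact (eq_neg_of_add_eq_zero_right h2).trans h3.symm
    · simp only [P, P', submatrix_apply, Prod.map_apply, Function.comp, hτ l h]
  have h2 := congrArg det h1
  rw [det_mul, det_mul, det_oneUpdateBlockCol, det_oneUpdateBlockCol, if_pos rfl, det_neg,
    Fintype.card_fin] at h2
  have h3 : P'.det =
      (M.submatrix (Prod.map (τ.symm.trans e) id) (Prod.map Subtype.val id)).det := by
    rw [← det_submatrix_equiv_self (τ.prodCongr (Equiv.refl (Fin n)))]
    congr 1
    ext ⟨k, a⟩ ⟨l, b⟩
    simp [P']
  obtain ⟨k, hk⟩ := det_submatrix_prodMap_equiv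
    (M.submatrix id (Prod.map (Subtype.val : {x // x ≠ i} → X) id)) (τ.symm.trans e) e'
  refine ⟨k + 1, h2.trans ?_⟩
  rw [h3]
  refine (congrArg (· * ((-1) ^ n * (v j).det)) hk).trans ?_
  simp only [submatrix_submatrix, Function.id_comp, Function.comp_id]
  ring

end Matrix
/-! ### Independence of the deleted generator -/

namespace TwistedAlexander

variable {X I : Type*} {R : Type*} [CommRing R] {m n : ℕ}
  (r : I → FreeGroup X)
  (α : PresentedGroup (Set.range r) →* Multiplicative (Fin m → ℤ))
  (ρ : PresentedGroup (Set.range r) →* Matrix.GeneralLinearGroup (Fin n) R)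

theorem Omega_of (w : FreeGroup X) :
    Omega r α ρ (MonoidAlgebra.of ℤ (FreeGroup X) w) =
      tensorHom r α ρ (PresentedGroup.mk (Set.range r) w) := by
  rw [Omega, MonoidAlgebra.lift_of]
  rfl

theorem mk_relator (i : I) : PresentedGroup.mk (Set.range r) (r i) = 1 :=
  PresentedGroup.one_of_mem (Set.mem_range_self i)

variable [Fintype X] [DecidableEq X]

/-- This is `Ω` of the negated fundamental formula for a relator; the right-hand side vanishes
because relators map to `1`. -/
theorem presMatrix_relation (i : I × Fin n) (b : Fin n) :
    ∑ x, ∑ a, presMatrix r α ρ i (x, a) *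
      Omega r α ρ (1 - MonoidAlgebra.of ℤ (FreeGroup X) (FreeGroup.of x)) a b = 0 := by
  have h := congrArg (fun z => Omega r α ρ (-z) i.2 b) (sum_foxDeriv_mul (r i.1))
  simp only [← Finset.sum_neg_distrib, ← mul_neg, neg_sub] at h
  rw [map_sub, map_one, Omega_of, mk_relator, map_one, sub_self, map_sum, Matrix.sum_apply] at h
  simp only [map_mul, Matrix.mul_apply] at h
  exact h

/-- The determinant of the presentation matrix without the `j`-th block column. -/
noncomputable def detDel (j : X) (e : {x : X // x ≠ j} ≃ I) : LaurentRing R m :=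
  ((presMatrixDel r α ρ j).submatrix (Prod.map e id) id).det

theorem detDel_mul_denom {i j : X} (e : {x : X // x ≠ j} ≃ I) (e' : {x : X // x ≠ i} ≃ I) :
    ∃ k : ℕ, detDel r α ρ j e * denom r α ρ i =
      ((-1) ^ k) ^ n * (detDel r α ρ i e' * denom r α ρ j) :=
  Matrix.det_delete_blockCol (presMatrix r α ρ) _ (presMatrix_relation r α ρ) e e'

/-- The matrix is square, so every maximal minor is this determinant with permuted rows. -/
theorem isGCDOf_minors {j : X} (e : {x : X // x ≠ j} ≃ I) :
    IsGCDOf (minors r α ρ j) (detDel r α ρ j e) := by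
  classical
  have : Fintype I := Fintype.ofEquiv _ e
  refine ⟨?_, fun d hd => hd _ ⟨(e.prodCongr (Equiv.refl _)).toEmbedding, rfl⟩⟩
  rintro _ ⟨f, rfl⟩
  obtain ⟨u, hu⟩ := Matrix.det_submatrix_embedding (presMatrixDel r α ρ j)
    (e.prodCongr (Equiv.refl _)) f
  exact ⟨u, hu.trans (mul_comm _ _)⟩

theorem IsNormalizedTwistedAlexander.isTwistedAlexander {H : LaurentRing R m}
    (h : IsNormalizedTwistedAlexander r α ρ H) : IsTwistedAlexander r α ρ H := by
  obtain ⟨j, hj, e, he⟩ := h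
  exact ⟨j, hj, _, isGCDOf_minors r α ρ e, he⟩

variable {r α ρ} [IsDomain R]

theorem IsNormalizedTwistedAlexander.eq_mul {H H₀ : LaurentRing R m}
    (h : IsNormalizedTwistedAlexander r α ρ H) (h₀ : IsNormalizedTwistedAlexander r α ρ H₀) :
    ∃ k : ℕ, H = ((-1) ^ k) ^ n * H₀ := by
  obtain ⟨j, hj, e, he⟩ := h
  obtain ⟨i, hi, e', he'⟩ := h₀
  obtain ⟨k, hk⟩ := detDel_mul_denom r α ρ e e'
  refine ⟨k, mul_right_cancel₀ (mul_ne_zero hj hi) ?_⟩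
  rw [detDel, detDel, ← he, ← he'] at hk
  linear_combination hk

theorem IsTwistedAlexander.associated {H H₀ : LaurentRing R m}
    (h : IsTwistedAlexander r α ρ H) (h₀ : IsNormalizedTwistedAlexander r α ρ H₀) :
    Associated H H₀ := by
  obtain ⟨j, hj, Q, hQ, hH⟩ := h
  obtain ⟨i, hi, e', he'⟩ := h₀
  -- Transports the listing of the relators from the deleted generator `i` to `j`, so that a
  -- determinant is available there too.
  let τ : {x // x ≠ j} ≃ {x // x ≠ i} := (Equiv.swap i j).subtypeEquiv fun x => by
    rw [not_iff_not, Equiv.swap_apply_eq_iff, Equiv.swap_apply_left]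
  obtain ⟨k, hk⟩ := detDel_mul_denom r α ρ (τ.trans e') e'
  have hg := isGCDOf_minors r α ρ (τ.trans e')
  have hQd : Associated Q (detDel r α ρ j (τ.trans e')) :=
    associated_of_dvd_dvd (hg.2 _ hQ.1) (hQ.2 _ hg.1)
  refine Associated.of_mul_right ?_ (Associated.refl (denom r α ρ j * denom r α ρ i))
    (mul_ne_zero hj hi)
  have h1 : Associated (Q * denom r α ρ i) (H₀ * denom r α ρ i * denom r α ρ j) := by
    refine (hQd.mul_right _).trans ?_
    rw [hk, he', detDel]
    exact associated_unit_mul_left _ _ ((isUnit_one.neg.pow k).pow n)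
  rw [← hH] at h1
  rwa [mul_assoc H, mul_assoc H₀, mul_comm (denom r α ρ i)] at h1

end TwistedAlexander
/-! ### The substitution `s ↦ s q⁻¹`, `t ↦ t q`, `q ↦ 1` -/

namespace LaurentRing

variable {R : Type*} [CommRing R]

/-- The substitution `H(s, t, q) ↦ H(s q⁻¹, t q, 1)` as a homomorphism. -/
noncomputable def substHom (R : Type*) [CommRing R] : LaurentRing R 3 →ₐ[R] LaurentRing R 3 :=
  eval ![var R 0 * (var R 2)⁻¹, var R 1 * var R 2, 1]

/-- The power `q^k`. -/
noncomputable def qPow (R : Type*) [CommRing R] (k : ℤ) : LaurentRing R 3 :=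
  monomial R (Multiplicative.ofAdd (Pi.single 2 k))

theorem qPow_add (a b : ℤ) : qPow R (a + b) = qPow R a * qPow R b := by
  rw [qPow, Pi.single_add, ofAdd_add, map_mul]
  rfl

theorem qPow_zero : qPow R 0 = 1 := by
  rw [qPow, Pi.single_zero, ofAdd_zero, map_one]

/-- The exponent of `q` in a monomial in `s q⁻¹`, `t q`, `q`. -/
def weight (e : Multiplicative (Fin 3 → ℤ)) : ℤ :=
  Multiplicative.toAdd e 2 - Multiplicative.toAdd e 1 + Multiplicative.toAdd e 0

theorem weight_mul (e f : Multiplicative (Fin 3 → ℤ)) : weight (e * f) = weight e + weight f := by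
  simp only [weight, toAdd_mul, Pi.add_apply]
  ring

theorem weight_inv (e : Multiplicative (Fin 3 → ℤ)) : weight e⁻¹ = -weight e := by
  simp only [weight, toAdd_inv, Pi.neg_apply]
  ring

/-- Write the monomial as `(s q⁻¹)^a (t q)^b q^w` with `w` its weight: the first two factors are
fixed and the last becomes `1`. -/
theorem substHom_monomial (e : Multiplicative (Fin 3 → ℤ)) :
    substHom R (monomial R e) = qPow R (-weight e) * monomial R e := by
  have h1 : substHom R (monomial R e) =
      powHom ![var R 0 * (var R 2)⁻¹, var R 1 * var R 2, 1] e := by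
    simp only [substHom, eval, monomial, AddMonoidAlgebra.of_apply, AddMonoidAlgebra.lift_single,
      one_smul, ofAdd_toAdd]
  have h2 : ∀ f, monomial R f = (unitMonomial R f : (LaurentRing R 3)ˣ) := fun f => rfl
  rw [h1, qPow, ← map_mul, h2]
  simp only [powHom, MonoidHom.coe_mk, OneHom.coe_mk, Fin.prod_univ_three, var]
  simp only [Matrix.cons_val, ← map_inv, ← map_mul, ← map_zpow, one_zpow, mul_one]
  congr 2
  refine Multiplicative.toAdd.injective (funext fun i => ?_)
  fin_cases i <;> simp [weight]; ring

/-- A matrix is homogeneous of degree `d` if the substitution multiplies its entries by `q^{-d}`. -/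
def IsHomogeneous {ι κ : Type*} (d : ℤ) (Z : Matrix ι κ (LaurentRing R 3)) : Prop :=
  ∀ i j, substHom R (Z i j) = qPow R (-d) * Z i j

namespace IsHomogeneous

variable {ι κ μ : Type*} {d d' : ℤ}

theorem zero : IsHomogeneous d (0 : Matrix ι κ (LaurentRing R 3)) := fun i j => by simp

theorem one [DecidableEq ι] : IsHomogeneous 0 (1 : Matrix ι ι (LaurentRing R 3)) := fun i j => by
  rw [neg_zero, qPow_zero, one_mul, Matrix.one_apply]
  split_ifs <;> simp

theorem add {Z Z' : Matrix ι κ (LaurentRing R 3)} (h : IsHomogeneous d Z)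
    (h' : IsHomogeneous d Z') : IsHomogeneous d (Z + Z') := fun i j => by
  rw [Matrix.add_apply, map_add, h, h', mul_add]

theorem neg {Z : Matrix ι κ (LaurentRing R 3)} (h : IsHomogeneous d Z) :
    IsHomogeneous d (-Z) := fun i j => by
  rw [Matrix.neg_apply, map_neg, h, mul_neg]

theorem mul [Fintype κ] {Z : Matrix ι κ (LaurentRing R 3)} {Z' : Matrix κ μ (LaurentRing R 3)}
    (h : IsHomogeneous d Z) (h' : IsHomogeneous d' Z') : IsHomogeneous (d + d') (Z * Z') :=
  fun i j => by
    rw [Matrix.mul_apply, map_sum, Finset.mul_sum]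
    refine Finset.sum_congr rfl fun k _ => ?_
    rw [map_mul, h, h', neg_add, qPow_add]
    ring

end IsHomogeneous

/-- The determinant of a square matrix that is homogeneous with respect to a grading of its
index set is invariant under the substitution. -/
theorem substHom_det {ι : Type*} [Fintype ι] [DecidableEq ι] (N : Matrix ι ι (LaurentRing R 3))
    (l : ι → ℤ) (h : ∀ i j, substHom R (N i j) = qPow R (-(l i - l j)) * N i j) :
    substHom R N.det = N.det := by
  -- The image of `N` is its conjugate by the diagonal matrix of the `q^{l i}`; the row and column
  -- factors cancel in the determinant.
  have h1 : (substHom R).mapMatrix N = Matrix.of fun i j => qPow R (-l i) *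
      (Matrix.of fun i j => qPow R (l j) * N i j) i j := by
    ext1 i j
    simp only [AlgHom.mapMatrix_apply, Matrix.map_apply, Matrix.of_apply, h]
    rw [← mul_assoc, ← qPow_add]
    congr 2
    ring
  rw [AlgHom.map_det, h1, Matrix.det_mul_column, Matrix.det_mul_row, ← mul_assoc,
    ← Finset.prod_mul_distrib]
  simp [← qPow_add, qPow_zero]

/-- `det (1 - x A)` is nonzero for a nontrivial monomial `x` and a matrix `A` of constants. -/
theorem det_one_sub_monomial_smul_ne_zero [Nontrivial R] {m n : ℕ} (A : Matrix (Fin n) (Fin n) R)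
    {e : Multiplicative (Fin m → ℤ)} (he : e ≠ 1) :
    (1 - monomial R e • A.map (const (m := m))).det ≠ 0 := by
  -- The determinant is the reversed characteristic polynomial at the monomial. Its constant
  -- coefficient is `1`, and positive powers of a nontrivial monomial do not contribute to exponent
  -- zero, as `ℤ^m` is torsion-free.
  have h1 : (1 - monomial R e • A.map (const (m := m))).det =
      Polynomial.aeval (monomial R e) A.charpolyRev := by
    rw [Matrix.charpolyRev, AlgHom.map_det]
    congr 1
    ext1 i j
    by_cases hij : i = j <;> simp [hij, const] <;> exact mul_comm _ _
  have h2 : (Polynomial.aeval (monomial R e) A.charpolyRev).coeff 0 = 1 := by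
    rw [Polynomial.aeval_eq_sum_range, AddMonoidAlgebra.coeff_sum, Finsupp.finsetSum_apply,
      Finset.sum_eq_single 0]
    · rw [Polynomial.coeff_zero_eq_eval_zero, Matrix.eval_charpolyRev]
      simp [AddMonoidAlgebra.one_def]
    · intro k _ hk
      have : k • Multiplicative.toAdd e ≠ 0 := smul_ne_zero hk he
      rw [nsmul_eq_mul] at this
      simp [monomial, AddMonoidAlgebra.of_apply, this]
    · simp
  intro h0
  rw [← h1, h0] at h2
  simp at h2

end LaurentRing
/-! ### The twisted virtual Alexander polynomial -/

namespace VirtualLinkDiagram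

open LaurentRing TwistedAlexander

variable (D : VirtualLinkDiagram) {R : Type*} [CommRing R] {n : ℕ}
  (ρ : D.VG →* Matrix.GeneralLinearGroup (Fin n) R)

/-- The twisted Fox derivative `Ω(∂w/∂x)` with respect to a short arc. -/
noncomputable def arcDeriv (w : FreeGroup D.Gen) (x : D.ShortArc) :
    Matrix (Fin n) (Fin n) (LaurentRing R 3) :=
  Omega D.relator D.alpha ρ (foxDeriv w (Sum.inl x))

/-- The weight of a word. -/
def wordWeight (w : FreeGroup D.Gen) : ℤ :=
  weight (D.alpha (PresentedGroup.mk (Set.range D.relator) w))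

theorem wordWeight_mul (v w : FreeGroup D.Gen) :
    D.wordWeight (v * w) = D.wordWeight v + D.wordWeight w := by
  simp [wordWeight, weight_mul]

theorem wordWeight_inv (w : FreeGroup D.Gen) : D.wordWeight w⁻¹ = -D.wordWeight w := by
  simp [wordWeight, weight_inv]

theorem alpha_of (x : D.Gen) :
    D.alpha (PresentedGroup.mk (Set.range D.relator) (FreeGroup.of x)) = D.abelGen x :=
  PresentedGroup.toGroup.of (h := D.abelGen_relator)

theorem wordWeight_arc (x : D.ShortArc) :
    D.wordWeight (FreeGroup.of (Sum.inl x)) = -1 := by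
  simp [wordWeight, alpha_of, abelGen, weight]

theorem wordWeight_gs : D.wordWeight D.gs = 1 := by
  simp [wordWeight, gs, alpha_of, abelGen, weight]

theorem wordWeight_gq : D.wordWeight D.gq = 1 := by
  simp [wordWeight, gq, alpha_of, abelGen, weight]

/-- The matrix is one monomial times a matrix of constants, which the substitution fixes. -/
theorem isHomogeneous_tensorHom (w : FreeGroup D.Gen) :
    IsHomogeneous (D.wordWeight w)
      (tensorHom D.relator D.alpha ρ (PresentedGroup.mk (Set.range D.relator) w)) := fun i j => by
  simp only [tensorHom, MonoidHom.coe_mk, OneHom.coe_mk, Matrix.smul_apply, Matrix.map_apply,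
    smul_eq_mul, map_mul, substHom_monomial, const, AlgHom.commutes, mul_assoc]
  rfl

/-- For a numbering `l` of the short arcs, all derivatives `Ω(∂w/∂x)` are homogeneous of degree
`k - l(x)`. -/
def HasHomogeneousDeriv (l : D.ShortArc → ℤ) (k : ℤ) (w : FreeGroup D.Gen) : Prop :=
  ∀ x, IsHomogeneous (k - l x) (D.arcDeriv ρ w x)

namespace HasHomogeneousDeriv

variable {D ρ} {l : D.ShortArc → ℤ} {k : ℤ}

theorem one : D.HasHomogeneousDeriv ρ l k 1 := fun x => by
  rw [arcDeriv, foxDeriv_one, map_zero]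
  exact IsHomogeneous.zero

theorem of_aux (a : Aux) : D.HasHomogeneousDeriv ρ l k (FreeGroup.of (Sum.inr a)) := fun x => by
  rw [arcDeriv, foxDeriv_of, if_neg (by simp), map_zero]
  exact IsHomogeneous.zero

theorem of_arc (y : D.ShortArc) :
    D.HasHomogeneousDeriv ρ l (l y) (FreeGroup.of (Sum.inl y)) := fun x => by
  rw [arcDeriv, foxDeriv_of]
  split_ifs with h
  · rw [Sum.inl.inj h, sub_self, map_one]
    exact IsHomogeneous.one
  · rw [map_zero]
    exact IsHomogeneous.zero

/-- In `∂(vw) = ∂v + v ∂w` the prefix `v` contributes its weight, hence the shifted degree required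
of `w`. -/
theorem mul {v w : FreeGroup D.Gen} (hv : D.HasHomogeneousDeriv ρ l k v)
    (hw : D.HasHomogeneousDeriv ρ l (k - D.wordWeight v) w) :
    D.HasHomogeneousDeriv ρ l k (v * w) := fun x => by
  rw [arcDeriv, foxDeriv_mul, map_add, map_mul, Omega_of]
  refine (hv x).add ?_
  rw [show k - l x = D.wordWeight v + (k - D.wordWeight v - l x) by ring]
  exact (D.isHomogeneous_tensorHom ρ v).mul (hw x)

theorem inv {w : FreeGroup D.Gen} (hw : D.HasHomogeneousDeriv ρ l (k + D.wordWeight w) w) :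
    D.HasHomogeneousDeriv ρ l k w⁻¹ := fun x => by
  rw [arcDeriv, foxDeriv_inv, map_neg, map_mul, Omega_of]
  rw [show k - l x = D.wordWeight w⁻¹ + (k + D.wordWeight w - l x) by rw [wordWeight_inv]; ring]
  exact ((D.isHomogeneous_tensorHom ρ w⁻¹).mul (hw x)).neg

end HasHomogeneousDeriv

/-- The derivatives of the relators are homogeneous with respect to an Alexander numbering. -/
theorem hasHomogeneousDeriv_relator {l : D.Slot → ℤ} (hl : ∀ c,
      l (c, Side.right) = l (c, Side.left) + 1 ∧
      l (D.next.symm (c, Side.left)) = l (c, Side.left) ∧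
      l (D.next.symm (c, Side.right)) = l (c, Side.left) + 1) (y : D.ShortArc) :
    D.HasHomogeneousDeriv ρ (Sum.elim l 0) (Sum.elim l 0 y) (D.relator (Sum.inl y)) := by
  have harc : ∀ (k : ℤ) (a : D.Slot), k = l a → D.HasHomogeneousDeriv ρ (Sum.elim l 0) k
      (FreeGroup.of (Sum.inl (Sum.inl a))) := fun k a h => by
    rw [h]
    exact HasHomogeneousDeriv.of_arc (Sum.inl a)
  have hs : ∀ k, D.HasHomogeneousDeriv ρ (Sum.elim l 0) k D.gs := fun k =>
    HasHomogeneousDeriv.of_aux Aux.s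
  have hq : ∀ k, D.HasHomogeneousDeriv ρ (Sum.elim l 0) k D.gq := fun k =>
    HasHomogeneousDeriv.of_aux Aux.q
  rcases y with ⟨c, x⟩ | y
  · obtain ⟨h1, h2, h3⟩ := hl c
    have hw : D.wordWeight (D.crossingWord c x) = -1 := by
      rcases hk : D.kind c <;> cases x <;>
        simp [crossingWord, hk, inArc, wordWeight_mul, wordWeight_inv, wordWeight_arc,
          wordWeight_gs, wordWeight_gq]
    refine HasHomogeneousDeriv.mul ?_ (HasHomogeneousDeriv.inv (harc _ _ ?_))
    -- The letters `s` and `q` have zero arc derivatives, so any degree suits them. What remains for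
    -- each arc letter is that its number is the degree shifted by the weight of its prefix. Since
    -- `s` and `q` have equal weight, classical and virtual crossings obey the same numbering rule.
    · rcases hk : D.kind c <;> cases x <;> simp only [crossingWord, hk, inArc] <;>
        repeat' first
          | with_reducible exact hs _
          | with_reducible exact hq _
          | with_reducible refine HasHomogeneousDeriv.mul ?_ ?_
          | with_reducible refine HasHomogeneousDeriv.inv ?_
          | with_reducible refine harc _ _ ?_
      all_goals
        simp only [wordWeight_mul, wordWeight_inv, wordWeight_arc, wordWeight_gs, wordWeight_gq,
          h1, h2, h3, Sum.elim_inl]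
        try ring
    · rw [hw, outArc, wordWeight_arc]
      simp
  · exact HasHomogeneousDeriv.one

/-- The twisted Fox derivatives of the crossing relators with respect to the short arcs. -/
noncomputable def arcMatrix :
    Matrix (D.ShortArc × Fin n) (D.ShortArc × Fin n) (LaurentRing R 3) :=
  fun i j => D.arcDeriv ρ (D.relator (Sum.inl i.1)) j.1 i.2 j.2

/-- Planarity enters here, through the Alexander numbering. Crossingless components may be numbered
`0`, since their relators are trivial and give zero rows. -/
theorem substHom_det_arcMatrix :
    substHom R (D.arcMatrix ρ).det = (D.arcMatrix ρ).det := by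
  obtain ⟨l, hl⟩ := D.exists_numbering D.planar
  exact substHom_det _ (fun i => Sum.elim l 0 i.1) fun i j =>
    D.hasHomogeneousDeriv_relator ρ hl i.1 j.1 i.2 j.2

/-! ### Deleting the column of `q` -/

/-- The generators other than `q` correspond to the relators. -/
def relatorEquiv : {x : D.Gen // x ≠ Sum.inr Aux.q} ≃ D.ShortArc ⊕ Unit where
  toFun
    | ⟨Sum.inl x, _⟩ => Sum.inl x
    | ⟨Sum.inr _, _⟩ => Sum.inr ()
  invFun
    | Sum.inl x => ⟨Sum.inl x, by simp⟩
    | Sum.inr _ => ⟨Sum.inr Aux.s, by simp⟩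
  left_inv := by
    rintro ⟨x | _ | _, h⟩
    · rfl
    · rfl
    · exact absurd rfl h
  right_inv := by
    rintro (x | _) <;> rfl

/-- The derivative is `1 - s q s⁻¹`, and `s q s⁻¹ = q` in the group. -/
theorem Omega_foxDeriv_commutator_gs :
    Omega D.relator D.alpha ρ (foxDeriv (D.relator (Sum.inr ())) (Sum.inr Aux.s)) =
      Omega D.relator D.alpha ρ (1 - MonoidAlgebra.of ℤ _ (FreeGroup.of (Sum.inr Aux.q))) := by
  have h : PresentedGroup.mk (Set.range D.relator) (D.gs * D.gq * D.gs⁻¹) =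
      PresentedGroup.mk (Set.range D.relator) D.gq := by
    have := mk_relator D.relator (Sum.inr ())
    rw [relator, map_mul, map_inv] at this
    exact mul_inv_eq_one.1 this
  have hd : foxDeriv (D.relator (Sum.inr ())) (Sum.inr Aux.s) =
      1 - MonoidAlgebra.of ℤ _ (D.gs * D.gq * D.gs⁻¹) := by
    simp only [relator, foxDeriv_mul, foxDeriv_inv]
    simp only [gs, gq, foxDeriv_of, if_true, map_mul]
    simp [sub_eq_add_neg]
  rw [hd, map_sub, map_sub, Omega_of, h, ← Omega_of]
  rfl

theorem arcDeriv_commutator (x : D.ShortArc) :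
    D.arcDeriv ρ (D.relator (Sum.inr ())) x = 0 := by
  have : foxDeriv (D.relator (Sum.inr ())) (Sum.inl x) = 0 := by
    simp [relator, foxDeriv_mul, foxDeriv_inv, gs, gq, foxDeriv_of]
  rw [arcDeriv, this, map_zero]

/-- With the commutator row and the `s` column listed last, the matrix is block upper triangular. -/
theorem detDel_gq :
    detDel D.relator D.alpha ρ (Sum.inr Aux.q) D.relatorEquiv =
      (D.arcMatrix ρ).det * denom D.relator D.alpha ρ (Sum.inr Aux.q) := by
  let f : (D.ShortArc × Fin n) ⊕ (Unit × Fin n) ≃ {x : D.Gen // x ≠ Sum.inr Aux.q} × Fin n :=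
    (Equiv.sumProdDistrib _ _ _).symm.trans (D.relatorEquiv.symm.prodCongr (Equiv.refl _))
  rw [detDel, ← Matrix.det_submatrix_equiv_self f]
  set M := ((presMatrixDel D.relator D.alpha ρ (Sum.inr Aux.q)).submatrix
    (Prod.map D.relatorEquiv id) id).submatrix f f
  have h21 : M.toBlocks₂₁ = 0 := by
    ext1 i j
    exact congrFun (congrFun (D.arcDeriv_commutator ρ j.1) i.2) j.2
  rw [← Matrix.fromBlocks_toBlocks M, h21, Matrix.det_fromBlocks_zero₂₁]
  congr 1
  rw [denom, ← Omega_foxDeriv_commutator_gs,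
    ← Matrix.det_submatrix_equiv_self (Equiv.uniqueProd (Fin n) Unit)]
  rfl

theorem denom_gq_ne_zero [Nontrivial R] :
    denom D.relator D.alpha ρ (Sum.inr Aux.q) ≠ 0 := by
  rw [denom, map_sub, map_one, Omega_of]
  refine det_one_sub_monomial_smul_ne_zero _ fun h => ?_
  rw [alpha_of] at h
  have := congrFun (congrArg Multiplicative.toAdd h) 2
  simp [abelGen] at this

theorem isNormalized_det_arcMatrix [Nontrivial R] :
    IsNormalizedTwistedAlexander D.relator D.alpha ρ (D.arcMatrix ρ).det :=
  ⟨Sum.inr Aux.q, D.denom_gq_ne_zero ρ, D.relatorEquiv, (D.detDel_gq ρ).symm⟩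

end VirtualLinkDiagram

theorem mainTheorem12 {R : Type*} [CommRing R] [IsDomain R] [UniqueFactorizationMonoid R]
    (D : VirtualLinkDiagram) (n : ℕ) (ρ : D.VG →* Matrix.GeneralLinearGroup (Fin n) R) :
    (∃ H : LaurentRing R 3,
      D.IsTwistedVirtualAlexander ρ H ∧ D.IsNormalizedTwistedVirtualAlexander ρ H) ∧
    (∀ H H' : LaurentRing R 3, D.IsTwistedVirtualAlexander ρ H →
      D.IsTwistedVirtualAlexander ρ H' → Associated H (substSTQ H')) ∧
    (∀ H H' : LaurentRing R 3, D.IsNormalizedTwistedVirtualAlexander ρ H →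
      D.IsNormalizedTwistedVirtualAlexander ρ H' →
        D.EqUpToIndeterminacy ρ H (substSTQ H')) := by
  have h₀ := D.isNormalized_det_arcMatrix ρ
  have hs := D.substHom_det_arcMatrix ρ
  refine ⟨⟨_, h₀.isTwistedAlexander, h₀⟩, fun H H' h h' => ?_, fun H H' h h' => ?_⟩
  -- Both values are compared with `det (arcMatrix)`, which the substitution fixes.
  · have h1 := (h'.associated h₀).map (LaurentRing.substHom R)
    rw [hs] at h1
    exact (h.associated h₀).trans h1.symm
  · obtain ⟨k, hk⟩ := h.eq_mul h₀
    obtain ⟨k', hk'⟩ := h₀.eq_mul h'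
    have h1 := congrArg (LaurentRing.substHom R) hk'
    rw [hs] at h1
    have h2 : H = ((-1) ^ (k + k')) ^ n * substSTQ H' := by
      rw [hk, h1]
      simp only [map_mul, map_pow, map_neg, map_one, pow_add, mul_pow, mul_assoc]
      rfl
    constructor
    -- Only a sign `(±1)^n` occurs, so the trivial monomial serves in both cases.
    · refine ⟨((-1) ^ (k + k')) ^ n, 1, ?_⟩
      simpa using h2
    · refine fun _ => ⟨k + k', 1, ?_⟩
      simpa using h2
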